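/- Let $\mathcal X$ be a metric space with a finite Borel measure $\omega$ of full support, and let $k:\mathcal X\times\mathcal X\to\mathbb R$ be a continuous, symmetric, positive definite kernel (all Gram matrices are positive semidefinite) with bounded diagonal $x\mapsto k(x,x)$. Let $\mathcal F$ be the reproducing kernel Hilbert space of $k$, and write $\langle\cdot,\cdot\rangle_\omega$, $\|\cdot\|_\omega$ for the inner product and norm of $L^2(\omega)$. Assume that $L^2(\omega)$ is infinite-dimensional and that all eigenvalues of the integral operator $\boldsymbol\Sigma g(x)=\int k(x,y)g(y)\,d\omega(y)$ on $L^2(\omega)$ are positive. Let $(e_m)_{m\ge 1}$ be an orthonormal basis of $L^2(\omega)$ with $\boldsymbol\Sigma e_m=\sigma_m e_m$, where $\sigma_1\ge\sigma_2\ge\dots>0$ and each $e_m$ is taken to be its continuous representative $\sigma_m^{-1}\boldsymbol\Sigma e_m$. Let $f\in\mathcal F$. For $M\ge 1$ let $f_M=\sum_{m=1}^M\langle f,e_m\rangle_\omega e_m$ be the $L^2(\omega)$-orthogonal projection of $f$ onto $\mathrm{Span}(e_1,\dots,e_M)$. For $\boldsymbol x=(x_1,\dots,x_N)\in\mathcal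 X^N$ let $\hat f_{\mathrm{LS},\boldsymbol x}$ be the $L^2(\omega)$-orthogonal projection of $f$ onto $\mathrm{Span}\{k(x_1,\cdot),\dots,k(x_N,\cdot)\}$. Theorem. Let $N\ge 1$, and let $\boldsymbol x=(x_1,\dots,x_N)$ be a random vector distributed according to the projection DPP of kernel $k_{0,[N]}(x,y)=\sum_{m=1}^N e_m(x)e_m(y)$ and reference measure $\omega$, that is, with law $$\frac1{N!}\det\big(k_{0,[N]}(x_i,x_j)\big)_{1\le i,j\le N}\,d\omega(x_1)\cdots d\omega(x_N).$$ Then $\sum_{m\ge N+1}\sigma_m^2<\infty$, the random variable $\|f-\hat f_{\mathrm{LS},\boldsymbol x}\|_\omega^2$ is integrable, and $$\mathbb E\,\|f-\hat f_{\mathrm{LS},\boldsymbol x}\|_\omega^2\ \le\ 2\min_{1\le M\le N}\Big(\|f-f_M\|_\omega^2+\sum_{n=1}^M\frac{\langle f,e_n\rangle_\omega^2}{\sigma_n^2}\ \sum_{m\ge N+1}\sigma_m^2\Big).$$ -/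

import Mathlib

open MeasureTheory ProbabilityTheory

namespace DPPLeastSquares

/-- The Hilbert space of functions `F` is the reproducing kernel Hilbert space of the real-valued
kernel `k`. (`RKHS.kernel F x y` is a continuous linear map from `ℝ` to `ℝ`; it has to be the
multiplication by the number `k x y`.) -/
def HasKernel {X : Type*} (F : Type*) [NormedAddCommGroup F] [InnerProductSpace ℝ F] [CompleteSpace F]
    [RKHS ℝ F X ℝ] (k : X → X → ℝ) : Prop :=
  ∀ (x y : X) (c : ℝ), RKHS.kernel F x y c = k x y * c

section Kernel

variable {X : Type*} [MetricSpace X]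

/-- The standing assumptions on the kernel `k`: it is symmetric and positive definite (all its Gram
matrices are positive semidefinite), its diagonal is bounded, and it is continuous. -/
structure IsAdmissibleKernel (k : X → X → ℝ) : Prop where
  posSemidef : (Matrix.of k).PosSemidef
  bounded_diag : ∃ C : ℝ, ∀ x, k x x ≤ C
  continuous : Continuous (Function.uncurry k)

theorem IsAdmissibleKernel.symm {k : X → X → ℝ} (hk : IsAdmissibleKernel k) (x y : X) :
    k x y = k y x := by
  have := hk.posSemidef.isHermitian.apply y x
  simpa using this

theorem IsAdmissibleKernel.sq_le {k : X → X → ℝ} (hk : IsAdmissibleKernel k) (x y : X) :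
    k x y ^ 2 ≤ k x x * k y y := by
  have h := (hk.posSemidef.submatrix ![x, y]).det_nonneg
  rw [Matrix.det_fin_two] at h
  simp only [Matrix.submatrix_apply, Matrix.of_apply, Matrix.cons_val_zero,
    Matrix.cons_val_one] at h
  rw [hk.symm y x] at h
  nlinarith

theorem IsAdmissibleKernel.diag_nonneg {k : X → X → ℝ} (hk : IsAdmissibleKernel k) (x : X) :
    0 ≤ k x x := hk.posSemidef.diag_nonneg (i := x)

theorem IsAdmissibleKernel.exists_bound {k : X → X → ℝ} (hk : IsAdmissibleKernel k) :
    ∃ C : ℝ, ∀ x y, |k x y| ≤ C := by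
  obtain ⟨C, hC⟩ := hk.bounded_diag
  refine ⟨C, fun x y => ?_⟩
  have h0 : 0 ≤ C := (hk.diag_nonneg x).trans (hC x)
  refine abs_le_of_sq_le_sq ?_ h0
  calc k x y ^ 2 ≤ k x x * k y y := hk.sq_le x y
    _ ≤ C * C := mul_le_mul (hC x) (hC y) (hk.diag_nonneg y) h0
    _ = C ^ 2 := by ring

end Kernel

section Spectral

variable {X : Type*} [MeasurableSpace X]

/-- The integral operator `Σ` of the kernel `k`, `Σ g (x) = ∫ k(x, y) g(y) dω(y)`. -/
noncomputable def integralOp (ω : Measure X) (k : X → X → ℝ) (g : X → ℝ) (x : X) : ℝ :=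
  ∫ y, k x y * g y ∂ω

/-- `b` is an orthonormal basis of `L²(ω)` made of eigenvectors of `Σ`, with eigenvalues `σ` that
are positive and non-increasing. The indices are shifted by one: `b m` and `σ m` with `m : ℕ` are
the eigenvector and the eigenvalue of index `m + 1`. -/
structure IsEigensystem (ω : Measure X) (k : X → X → ℝ)
    (b : HilbertBasis ℕ ℝ (Lp ℝ 2 ω)) (σ : ℕ → ℝ) : Prop where
  eigen : ∀ m, integralOp ω k (b m) =ᵐ[ω] fun x => σ m * b m x
  pos : ∀ m, 0 < σ m
  antitone : Antitone σ

/-- The continuous representative `e_m = σ_m⁻¹ Σ b_m` of the eigenvector `b_m`; see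
`eigenfun_ae_eq` and `continuous_eigenfun`. -/
noncomputable def eigenfun (ω : Measure X) (k : X → X → ℝ)
    (b : HilbertBasis ℕ ℝ (Lp ℝ 2 ω)) (σ : ℕ → ℝ) (m : ℕ) (x : X) : ℝ :=
  (σ m)⁻¹ * integralOp ω k (b m) x

/-- The kernel `k_{0,T}(x, y) = ∑_{m ∈ T} e_m(x) e_m(y)`. -/
noncomputable def projKernel (e : ℕ → X → ℝ) (T : Finset ℕ) (x y : X) : ℝ :=
  ∑ m ∈ T, e m x * e m y

/-- The law on `X^N` with density `(1 / N!) det (κ(x_i, x_j))_{i,j}` with respect to `ω^{⊗ N}`. -/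
noncomputable def dppLaw (ω : Measure X) (κ : X → X → ℝ) (N : ℕ) : Measure (Fin N → X) :=
  (Measure.pi fun _ => ω).withDensity fun x =>
    ENNReal.ofReal ((N.factorial : ℝ)⁻¹ * (Matrix.of fun i j => κ (x i) (x j)).det)

/-- `eigenfun` agrees almost everywhere with the eigenvector. -/
theorem eigenfun_ae_eq {ω : Measure X} {k : X → X → ℝ} {b : HilbertBasis ℕ ℝ (Lp ℝ 2 ω)}
    {σ : ℕ → ℝ} (h : IsEigensystem ω k b σ) (m : ℕ) : eigenfun ω k b σ m =ᵐ[ω] b m := by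
  filter_upwards [h.eigen m] with x hx
  rw [eigenfun, hx, inv_mul_cancel_left₀ (h.pos m).ne']

end Spectral

section Approximation

variable {X : Type*} [MetricSpace X] [MeasurableSpace X] [BorelSpace X]

/-- The kernel translate `k(x, ·)` is square integrable. -/
theorem IsAdmissibleKernel.memLp_translate {k : X → X → ℝ} (hk : IsAdmissibleKernel k)
    (ω : Measure X) [IsFiniteMeasure ω] (x : X) : MemLp (k x) 2 ω := by
  obtain ⟨C, hC⟩ := hk.exists_bound
  have hc : Continuous (k x) := hk.continuous.comp (by fun_prop : Continuous fun y => (x, y))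
  exact MemLp.of_bound hc.aestronglyMeasurable C (Filter.Eventually.of_forall fun y => hC x y)

/-- `eigenfun` is continuous. -/
theorem continuous_eigenfun {ω : Measure X} [IsFiniteMeasure ω] {k : X → X → ℝ}
    (hk : IsAdmissibleKernel k) (b : HilbertBasis ℕ ℝ (Lp ℝ 2 ω)) (σ : ℕ → ℝ) (m : ℕ) :
    Continuous (eigenfun ω k b σ m) := by
  obtain ⟨C, hC⟩ := hk.exists_bound
  have hb : Integrable (fun y => b m y) ω := (Lp.memLp (b m)).integrable (by norm_num)
  refine continuous_const.mul ?_
  refine continuous_of_dominated (bound := fun y => C * ‖b m y‖) (fun x => ?_) (fun x => ?_)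
    (hb.norm.const_mul C) ?_
  · exact (hk.memLp_translate ω x).aestronglyMeasurable.mul hb.aestronglyMeasurable
  · refine Filter.Eventually.of_forall fun y => ?_
    rw [norm_mul]
    exact mul_le_mul_of_nonneg_right (hC x y) (norm_nonneg _)
  · refine Filter.Eventually.of_forall fun y => ?_
    have : Continuous fun x => k x y :=
      hk.continuous.comp (by fun_prop : Continuous fun x => (x, y))
    exact this.mul continuous_const

/-- The elements of the reproducing kernel Hilbert space are square integrable. -/
theorem memLp_rkhs {F : Type*} [NormedAddCommGroup F] [InnerProductSpace ℝ F] [CompleteSpace F]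
    [RKHS ℝ F X ℝ] {k : X → X → ℝ} (hk : IsAdmissibleKernel k) (hF : HasKernel F k)
    (ω : Measure X) [IsFiniteMeasure ω] (f : F) : MemLp (⇑f) 2 ω := by
  have hrep : ∀ x, f x = inner ℝ f (RKHS.kerFun F x (1 : ℝ)) := fun x => by simp
  have hin : ∀ x y, inner ℝ (RKHS.kerFun F x (1 : ℝ)) (RKHS.kerFun F y (1 : ℝ)) = k x y := by
    intro x y
    rw [hk.symm, ← RKHS.kernel_inner]
    simp [hF y x 1]
  have hcont : Continuous (⇑f : X → ℝ) := by
    rw [continuous_iff_continuousAt]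
    intro x
    have hd : Filter.Tendsto (fun y => ‖f‖ * √(k y y - 2 * k y x + k x x)) (nhds x) (nhds 0) := by
      have hc : Continuous fun y => ‖f‖ * √(k y y - 2 * k y x + k x x) := by
        have h1 : Continuous fun y => k y y :=
          hk.continuous.comp (by fun_prop : Continuous fun y => (y, y))
        have h2 : Continuous fun y => k y x :=
          hk.continuous.comp (by fun_prop : Continuous fun y => (y, x))
        exact continuous_const.mul (((h1.sub (continuous_const.mul h2)).add continuous_const).sqrt)
      have := hc.tendsto x
      simpa [show k x x - 2 * k x x + k x x = 0 by ring] using this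
    rw [ContinuousAt, tendsto_iff_dist_tendsto_zero]
    refine squeeze_zero (fun _ => dist_nonneg) (fun y => ?_) hd
    rw [Real.dist_eq, hrep, hrep, ← inner_sub_right]
    refine (abs_real_inner_le_norm _ _).trans (mul_le_mul_of_nonneg_left ?_ (norm_nonneg _))
    apply Real.le_sqrt_of_sq_le
    rw [@norm_sub_sq_real, ← real_inner_self_eq_norm_sq, ← real_inner_self_eq_norm_sq,
      hin, hin, hin]
  obtain ⟨C, hC⟩ := hk.bounded_diag
  refine MemLp.of_bound hcont.aestronglyMeasurable (‖f‖ * √C) (Filter.Eventually.of_forall ?_)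
  intro x
  rw [hrep, Real.norm_eq_abs]
  refine (abs_real_inner_le_norm _ _).trans (mul_le_mul_of_nonneg_left ?_ (norm_nonneg _))
  apply Real.le_sqrt_of_sq_le
  rw [← real_inner_self_eq_norm_sq, hin]
  exact hC x

/-- The class in `L²(ω)` of an element of the reproducing kernel Hilbert space. -/
noncomputable def toL2 {F : Type*} [NormedAddCommGroup F] [InnerProductSpace ℝ F]
    [CompleteSpace F] [RKHS ℝ F X ℝ] {k : X → X → ℝ} (hk : IsAdmissibleKernel k)
    (hF : HasKernel F k) (ω : Measure X) [IsFiniteMeasure ω] (f : F) : Lp ℝ 2 ω :=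
  (memLp_rkhs hk hF ω f).toLp f

/-- The class in `L²(ω)` of the kernel translate `k(x, ·)`. -/
noncomputable def translate {k : X → X → ℝ} (hk : IsAdmissibleKernel k)
    (ω : Measure X) [IsFiniteMeasure ω] (x : X) : Lp ℝ 2 ω :=
  (hk.memLp_translate ω x).toLp (k x)

/-- Finite families span subspaces onto which one can project. -/
instance hasOrthogonalProjection_span_range {E ι : Type*} [NormedAddCommGroup E]
    [InnerProductSpace ℝ E] [Finite ι] (v : ι → E) :
    (Submodule.span ℝ (Set.range v)).HasOrthogonalProjection :=
  haveI := FiniteDimensional.span_of_finite ℝ (Set.finite_range v)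
  inferInstance

/-- The least-squares approximation at the nodes `x_1, …, x_N`: the orthogonal projection, in
`L²(ω)`, onto the span of `k(x_1, ·), …, k(x_N, ·)`. -/
noncomputable def lsApprox {k : X → X → ℝ} (hk : IsAdmissibleKernel k)
    (ω : Measure X) [IsFiniteMeasure ω] {N : ℕ} (x : Fin N → X) (g : Lp ℝ 2 ω) : Lp ℝ 2 ω :=
  (Submodule.span ℝ (Set.range fun i => translate hk ω (x i))).starProjection g

/-- The orthogonal projection in `L²(ω)` onto the span of the first `M` eigenvectors. -/
noncomputable def eigenProj {ω : Measure X} (b : HilbertBasis ℕ ℝ (Lp ℝ 2 ω)) (M : ℕ)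
    (g : Lp ℝ 2 ω) : Lp ℝ 2 ω :=
  (Submodule.span ℝ (Set.range fun m : Fin M => b m)).starProjection g

end Approximation

end DPPLeastSquares

open DPPLeastSquares

/-! Let `E` be the matrix of the values `e_n(x_i)`, `n < N`; the DPP has density `det E ^ 2 / N!`.
If `det E ≠ 0`, some combination `h` of the translates `k(x_i, ·)` has the same first `N`
coefficients as `f_M`, because the `m`-th coefficient of `k(x, ·)` is `σ_m e_m(x)`. The
least-squares error is at most `‖f - h‖`, and `f_M - h` has only coefficients of index at least `N`.
By Cramer's rule (`det_mul_dotProduct_inv_mulVec`), such a coefficient times `det E` is, up to sign,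
`σ_m` times a combination, with weights `⟨f, e_n⟩ / σ_n` for `n < M`, of determinants of `E` with
row `n` replaced by the values of `e_m`. The density thus cancels the inverse of `E`. By Andréief's
identity (`integral_det_mul_det`) these determinants are orthogonal in `n` with squared norm `N!`,
so integrating `‖f_M - h‖ ^ 2` yields the second term of the bound. -/

namespace DPPLeastSquares

open scoped Matrix

/-! ### Integrals of products of determinants -/

section Andreief

variable {X : Type*} [MeasurableSpace X] {ι : Type*} [Fintype ι] [DecidableEq ι]

theorem integrable_det_mul_det {ω : Measure X} [SigmaFinite ω] {u v : ι → X → ℝ}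
    (hu : ∀ i, MemLp (u i) 2 ω) (hv : ∀ i, MemLp (v i) 2 ω) :
    Integrable (fun x : ι → X => (Matrix.of fun i j => u i (x j)).det *
      (Matrix.of fun i j => v i (x j)).det) (Measure.pi fun _ => ω) := by
  simp only [Matrix.det_apply', Finset.sum_mul_sum]
  refine integrable_finsetSum _ fun p _ => integrable_finsetSum _ fun q _ => ?_
  have h := Integrable.fintype_prod (μ := fun _ : ι => ω)
    (f := fun i y => u (p i) y * v (q i) y) fun i => (hu (p i)).integrable_mul (hv (q i))
  refine (h.const_mul (((Equiv.Perm.sign p : ℤ) : ℝ) * ((Equiv.Perm.sign q : ℤ) : ℝ))).congr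
    (Filter.Eventually.of_forall fun x => ?_)
  simp only [Matrix.of_apply, Finset.prod_mul_distrib]
  ring

/-- **Andréief's identity**. -/
theorem integral_det_mul_det {ω : Measure X} [SigmaFinite ω] {u v : ι → X → ℝ}
    (hu : ∀ i, MemLp (u i) 2 ω) (hv : ∀ i, MemLp (v i) 2 ω) :
    ∫ x : ι → X, (Matrix.of fun i j => u i (x j)).det * (Matrix.of fun i j => v i (x j)).det
        ∂(Measure.pi fun _ => ω) =
      (Fintype.card ι).factorial * (Matrix.of fun i j => ∫ y, u i y * v j y ∂ω).det := by
  set G : Matrix ι ι ℝ := Matrix.of fun i j => ∫ y, u i y * v j y ∂ω with hG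
  have hint : ∀ p q : Equiv.Perm ι, Integrable (fun x : ι → X =>
      (((Equiv.Perm.sign p : ℤ) : ℝ) * ((Equiv.Perm.sign q : ℤ) : ℝ)) *
        ∏ i, (u (p i) (x i) * v (q i) (x i))) (Measure.pi fun _ => ω) := fun p q =>
    (Integrable.fintype_prod (μ := fun _ : ι => ω) (f := fun i y => u (p i) y * v (q i) y)
      fun i => (hu (p i)).integrable_mul (hv (q i))).const_mul _
  have hexp : ∀ x : ι → X, (Matrix.of fun i j => u i (x j)).det *
      (Matrix.of fun i j => v i (x j)).det = ∑ p : Equiv.Perm ι, ∑ q : Equiv.Perm ι,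
      (((Equiv.Perm.sign p : ℤ) : ℝ) * ((Equiv.Perm.sign q : ℤ) : ℝ)) *
        ∏ i, (u (p i) (x i) * v (q i) (x i)) := by
    intro x
    simp only [Matrix.det_apply', Finset.sum_mul_sum, Matrix.of_apply, Finset.prod_mul_distrib]
    refine Finset.sum_congr rfl fun p _ => Finset.sum_congr rfl fun q _ => ?_
    ring
  simp only [hexp]
  rw [integral_finsetSum _ fun p _ => integrable_finsetSum _ fun q _ => hint p q]
  -- Every `p` contributes the same: the sum over `q` is the determinant of `G` with rows permuted
  -- by `p`, whose sign cancels `sign p`. The number of `p` gives the factorial.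
  have hp : ∀ p : Equiv.Perm ι, ∫ x : ι → X, ∑ q : Equiv.Perm ι,
      (((Equiv.Perm.sign p : ℤ) : ℝ) * ((Equiv.Perm.sign q : ℤ) : ℝ)) *
        ∏ i, (u (p i) (x i) * v (q i) (x i)) ∂(Measure.pi fun _ => ω) = G.det := by
    intro p
    rw [integral_finsetSum _ fun q _ => hint p q]
    have h1 : ∀ q : Equiv.Perm ι, ∫ x : ι → X,
        (((Equiv.Perm.sign p : ℤ) : ℝ) * ((Equiv.Perm.sign q : ℤ) : ℝ)) *
        ∏ i, (u (p i) (x i) * v (q i) (x i)) ∂(Measure.pi fun _ => ω) =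
        ((Equiv.Perm.sign p : ℤ) : ℝ) * (((Equiv.Perm.sign q : ℤ) : ℝ) *
          ∏ i, (G.submatrix p id)ᵀ (q i) i) := by
      intro q
      rw [integral_const_mul, integral_fintype_prod_eq_prod (𝕜 := ℝ) (μ := fun _ : ι => ω)
        (fun i y => u (p i) y * v (q i) y), mul_assoc]
      rfl
    simp only [h1]
    rw [← Finset.mul_sum, ← Matrix.det_apply', Matrix.det_transpose, Matrix.det_permute,
      ← mul_assoc]
    have : ((Equiv.Perm.sign p : ℤ) : ℝ) * ((Equiv.Perm.sign p : ℤ) : ℝ) = 1 := by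
      rcases Int.units_eq_one_or (Equiv.Perm.sign p) with h | h <;> simp [h]
    rw [this, one_mul]
  simp only [hp, Finset.sum_const, Finset.card_univ, Fintype.card_perm, nsmul_eq_mul]

end Andreief

/-! ### Determinants of eigenfunctions at the nodes -/

section EigenMatrix

variable {X : Type*}

/-- The matrix of the values of the first `N` eigenfunctions at `N` nodes. -/
noncomputable def eigenMatrix (e : ℕ → X → ℝ) {N : ℕ} (x : Fin N → X) :
    Matrix (Fin N) (Fin N) ℝ :=
  Matrix.of fun n i => e n (x i)

theorem det_projKernel (e : ℕ → X → ℝ) {N : ℕ} (x : Fin N → X) :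
    (Matrix.of fun i j => projKernel e (Finset.range N) (x i) (x j)).det =
      (eigenMatrix e x).det ^ 2 := by
  have : (Matrix.of fun i j => projKernel e (Finset.range N) (x i) (x j)) =
      (eigenMatrix e x)ᵀ * eigenMatrix e x := by
    ext i j
    simp [projKernel, eigenMatrix, Matrix.mul_apply, Finset.sum_range]
  rw [this, Matrix.det_mul, Matrix.det_transpose, sq]

/-- Replacing a row amounts to replacing an index in the family of eigenfunctions, which is the form
Andréief's identity takes. -/
theorem updateRow_eigenMatrix (e : ℕ → X → ℝ) {N : ℕ} (x : Fin N → X) (n : Fin N) (m : ℕ) :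
    (eigenMatrix e x).updateRow n (fun i => e m (x i)) =
      Matrix.of fun i j => e (Function.update (fun l : Fin N => (l : ℕ)) n m i) (x j) := by
  ext i j
  by_cases h : i = n
  · subst h; simp
  · simp [h, eigenMatrix]

end EigenMatrix

section Eigenfunctions

variable {X : Type*} [MeasurableSpace X] {ω : Measure X} {k : X → X → ℝ}
  {b : HilbertBasis ℕ ℝ (Lp ℝ 2 ω)} {σ : ℕ → ℝ}

theorem memLp_eigenfun (hb : IsEigensystem ω k b σ) (m : ℕ) :
    MemLp (eigenfun ω k b σ m) 2 ω :=
  (memLp_congr_ae (eigenfun_ae_eq hb m)).2 (Lp.memLp (b m))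

theorem integral_eigenfun_mul (hb : IsEigensystem ω k b σ) (m n : ℕ) :
    ∫ y, eigenfun ω k b σ m y * eigenfun ω k b σ n y ∂ω = if m = n then 1 else 0 := by
  rw [← orthonormal_iff_ite.1 b.orthonormal m n, L2.inner_def]
  refine integral_congr_ae ?_
  filter_upwards [eigenfun_ae_eq hb m, eigenfun_ae_eq hb n] with y h1 h2
  simp [h1, h2, mul_comm]

theorem integrable_det_updateRow_mul (hb : IsEigensystem ω k b σ) [SigmaFinite ω] {N : ℕ} (m : ℕ)
    (n l : Fin N) :
    Integrable (fun x : Fin N → X =>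
      ((eigenMatrix (eigenfun ω k b σ) x).updateRow n fun i => eigenfun ω k b σ m (x i)).det *
      ((eigenMatrix (eigenfun ω k b σ) x).updateRow l fun i => eigenfun ω k b σ m (x i)).det)
        (Measure.pi fun _ => ω) := by
  simp only [updateRow_eigenMatrix]
  exact integrable_det_mul_det (fun i => memLp_eigenfun hb _) (fun i => memLp_eigenfun hb _)

/-- The determinants obtained by replacing one row of the matrix of eigenfunctions by another
eigenfunction are orthogonal. -/
theorem integral_det_updateRow_mul (hb : IsEigensystem ω k b σ) [SigmaFinite ω] {N m : ℕ}
    (hm : N ≤ m) (n l : Fin N) :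
    ∫ x : Fin N → X,
      ((eigenMatrix (eigenfun ω k b σ) x).updateRow n fun i => eigenfun ω k b σ m (x i)).det *
      ((eigenMatrix (eigenfun ω k b σ) x).updateRow l fun i => eigenfun ω k b σ m (x i)).det
        ∂(Measure.pi fun _ => ω) = if n = l then (N.factorial : ℝ) else 0 := by
  simp only [updateRow_eigenMatrix]
  rw [integral_det_mul_det (fun i => memLp_eigenfun hb _) (fun i => memLp_eigenfun hb _)]
  simp only [integral_eigenfun_mul hb, Fintype.card_fin]
  split_ifs with h
  -- As `N ≤ m`, the updated index map is still injective, so the Gram matrix is the identity.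
  · subst h
    have : (Matrix.of fun i j : Fin N => if Function.update (fun l : Fin N => (l : ℕ)) n m i =
        Function.update (fun l : Fin N => (l : ℕ)) n m j then (1 : ℝ) else 0) = 1 := by
      ext i j
      have := i.2
      have := j.2
      simp only [Matrix.of_apply, Matrix.one_apply, Function.update_apply]
      grind
    rw [this, Matrix.det_one, mul_one]
  -- The index `l` survives in the first family and is missing from the second, so row `l` of the
  -- Gram matrix vanishes.
  · rw [Matrix.det_eq_zero_of_row_eq_zero l, mul_zero]
    intro j
    have := l.2
    rw [Matrix.of_apply, if_neg]
    simp only [Function.update_apply]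
    grind

theorem integrable_sum_det_updateRow_sq (hb : IsEigensystem ω k b σ) [SigmaFinite ω] {N : ℕ}
    (m : ℕ) (d : Fin N → ℝ) :
    Integrable (fun x : Fin N → X => (∑ n, d n *
      ((eigenMatrix (eigenfun ω k b σ) x).updateRow n fun i => eigenfun ω k b σ m (x i)).det) ^ 2)
        (Measure.pi fun _ => ω) := by
  simp only [sq, Finset.sum_mul_sum]
  refine integrable_finsetSum _ fun n _ => integrable_finsetSum _ fun l _ => ?_
  refine ((integrable_det_updateRow_mul hb m n l).const_mul (d n * d l)).congr
    (Filter.Eventually.of_forall fun x => ?_)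
  simp only
  ring

theorem integral_sum_det_updateRow_sq (hb : IsEigensystem ω k b σ) [SigmaFinite ω] {N m : ℕ}
    (hm : N ≤ m) (d : Fin N → ℝ) :
    ∫ x : Fin N → X, (∑ n, d n *
      ((eigenMatrix (eigenfun ω k b σ) x).updateRow n fun i => eigenfun ω k b σ m (x i)).det) ^ 2
        ∂(Measure.pi fun _ => ω) = N.factorial * ∑ n, d n ^ 2 := by
  simp only [sq, Finset.sum_mul_sum, mul_mul_mul_comm (d _)]
  rw [integral_finsetSum _ fun n _ => integrable_finsetSum _ fun l _ =>
    (integrable_det_updateRow_mul hb m n l).const_mul _]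
  simp only [integral_finsetSum _ fun l _ => (integrable_det_updateRow_mul hb m _ l).const_mul _,
    integral_const_mul, integral_det_updateRow_mul hb hm]
  simp [Finset.mul_sum, mul_comm]

end Eigenfunctions

/-! ### Cramer's rule, Hilbert bases and projections -/

section LinearAlgebra

/-- A form of Cramer's rule: the combination of the columns of `A` that equals `d`, applied to the
entries of the row `v`. -/
theorem det_mul_dotProduct_inv_mulVec {n : Type*} [Fintype n] [DecidableEq n]
    {A : Matrix n n ℝ} (hA : IsUnit A.det) (d v : n → ℝ) :
    A.det * ((A⁻¹ *ᵥ d) ⬝ᵥ v) = ∑ i, d i * (A.updateRow i v).det := by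
  have h1 : ∑ i, d i * (A.updateRow i v).det = d ⬝ᵥ Matrix.cramer Aᵀ v := by
    simp [dotProduct, Matrix.cramer_transpose_apply]
  have h2 : d = A *ᵥ (A⁻¹ *ᵥ d) := by
    rw [Matrix.mulVec_mulVec, Matrix.mul_nonsing_inv _ hA, Matrix.one_mulVec]
  rw [h1]
  conv_rhs => rw [h2]
  -- Moving `A` to the other side of the pairing leaves `Aᵀ *ᵥ cramer Aᵀ v = det A • v`.
  rw [← Matrix.vecMul_transpose A, ← Matrix.dotProduct_mulVec, Matrix.mulVec_cramer,
    Matrix.det_transpose, dotProduct_smul, smul_eq_mul]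

end LinearAlgebra

section Hilbert

variable {E : Type*} [NormedAddCommGroup E] [InnerProductSpace ℝ E]

theorem hasSum_inner_sq {ι : Type*} (b : HilbertBasis ι ℝ E) (g : E) :
    HasSum (fun m => inner ℝ (b m) g ^ 2) (‖g‖ ^ 2) := by
  have := b.hasSum_inner_mul_inner g g
  simpa [real_inner_comm, sq, real_inner_self_eq_norm_mul_norm] using this

theorem norm_sub_starProjection_le (K : Submodule ℝ E) [K.HasOrthogonalProjection] (g : E) {h : E}
    (hh : h ∈ K) : ‖g - K.starProjection g‖ ≤ ‖g - h‖ := by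
  rw [K.starProjection_minimal]
  exact ciInf_le (f := fun x : K => ‖g - x‖) ⟨0, by rintro _ ⟨x, rfl⟩; exact norm_nonneg _⟩ ⟨h, hh⟩

/-- The distance to the span of a finite family is an infimum over rational combinations. -/
theorem norm_sub_starProjection_span_sq {N : ℕ} (v : Fin N → E) (g : E) :
    ‖g - (Submodule.span ℝ (Set.range v)).starProjection g‖ ^ 2 =
      ⨅ w : Fin N → ℚ, ‖g - ∑ i, (w i : ℝ) • v i‖ ^ 2 := by
  have hbdd : BddBelow (Set.range fun w : Fin N → ℚ => ‖g - ∑ i, (w i : ℝ) • v i‖ ^ 2) :=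
    ⟨0, by rintro _ ⟨w, rfl⟩; positivity⟩
  refine le_antisymm (le_ciInf fun w => ?_) ?_
  · refine pow_le_pow_left₀ (norm_nonneg _) (norm_sub_starProjection_le _ _ ?_) 2
    exact Submodule.sum_mem _ fun i _ =>
      Submodule.smul_mem _ _ (Submodule.subset_span (Set.mem_range_self i))
  · obtain ⟨c, hc⟩ := (Submodule.mem_span_range_iff_exists_fun ℝ).1
      (Submodule.starProjection_apply_mem (Submodule.span ℝ (Set.range v)) g)
    rw [← hc]
    have hd : DenseRange (fun (w : Fin N → ℚ) i => (w i : ℝ)) :=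
      DenseRange.piMap fun _ => Rat.denseRange_cast
    refine hd.induction_on (p := fun c : Fin N → ℝ =>
      ⨅ w : Fin N → ℚ, ‖g - ∑ i, (w i : ℝ) • v i‖ ^ 2 ≤ ‖g - ∑ i, c i • v i‖ ^ 2) c ?_ ?_
    · exact isClosed_le continuous_const (by fun_prop)
    · exact fun w => ciInf_le hbdd w

end Hilbert

section EigenProj

variable {X : Type*} [MeasurableSpace X] {ω : Measure X}

theorem inner_eigenProj (b : HilbertBasis ℕ ℝ (Lp ℝ 2 ω)) (M : ℕ) (g : Lp ℝ 2 ω) (m : ℕ) :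
    inner ℝ (b m) (eigenProj b M g) = if m < M then inner ℝ (b m) g else 0 := by
  rw [eigenProj, ← Submodule.inner_starProjection_left_eq_right]
  split_ifs with h
  · have : b m ∈ Submodule.span ℝ (Set.range fun i : Fin M => b i) :=
      Submodule.subset_span ⟨⟨m, h⟩, rfl⟩
    rw [Submodule.starProjection_eq_self_iff.2 this]
  · have : b m ∈ (Submodule.span ℝ (Set.range fun i : Fin M => b i))ᗮ := by
      rw [Submodule.mem_orthogonal]
      intro u hu
      induction hu using Submodule.span_induction with
      | mem u hu =>
        obtain ⟨i, rfl⟩ := hu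
        exact b.orthonormal.2 (by have := i.2; omega)
      | zero => simp
      | add u v _ _ hu hv => rw [inner_add_left, hu, hv, add_zero]
      | smul a u _ hu => rw [inner_smul_left, hu, mul_zero]
    rw [(Submodule.starProjection_apply_eq_zero_iff _).2 this, inner_zero_left]

end EigenProj

/-! ### Kernel translates and the error estimate -/

section Translate

variable {X : Type*} [MetricSpace X] [MeasurableSpace X] [BorelSpace X]
  {ω : Measure X} [IsFiniteMeasure ω] {k : X → X → ℝ}
  {b : HilbertBasis ℕ ℝ (Lp ℝ 2 ω)} {σ : ℕ → ℝ}

/-- This holds at every `x`, not just almost everywhere, because `eigenfun` is defined through the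
integral operator. -/
theorem inner_translate (hk : IsAdmissibleKernel k) (hb : IsEigensystem ω k b σ) (m : ℕ) (x : X) :
    inner ℝ (b m) (translate hk ω x) = σ m * eigenfun ω k b σ m x := by
  rw [eigenfun, mul_inv_cancel_left₀ (hb.pos m).ne', integralOp, L2.inner_def]
  refine integral_congr_ae ?_
  filter_upwards [(hk.memLp_translate ω x).coeFn_toLp] with y hy
  rw [translate, hy]
  simp

theorem inner_sub_sum_translate (hk : IsAdmissibleKernel k) (hb : IsEigensystem ω k b σ) {N : ℕ}
    (x : Fin N → X) (w : Fin N → ℝ) (g : Lp ℝ 2 ω) (m : ℕ) :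
    inner ℝ (b m) (g - ∑ i, w i • translate hk ω (x i)) =
      inner ℝ (b m) g - σ m * ∑ i, w i * eigenfun ω k b σ m (x i) := by
  rw [inner_sub_right, inner_sum, Finset.mul_sum]
  congr 1
  refine Finset.sum_congr rfl fun i _ => ?_
  rw [inner_smul_right, inner_translate hk hb]
  ring

/-- Bessel's inequality bounds the partial sums of `σ_m ^ 2 e_m(x) ^ 2` by `‖k(x, ·)‖ ^ 2`,
uniformly in `x`; integrating over the finite measure `ω` removes the normalized `e_m`. -/
theorem summable_sq_eigenvalue (hk : IsAdmissibleKernel k) (hb : IsEigensystem ω k b σ) :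
    Summable fun m => σ m ^ 2 := by
  obtain ⟨C, hC⟩ := hk.exists_bound
  have hbd : ∃ B : ℝ, ∀ x, ‖translate hk ω x‖ ^ 2 ≤ B := by
    refine ⟨∫ _, C ^ 2 ∂ω, fun x => ?_⟩
    rw [← real_inner_self_eq_norm_sq, L2.inner_def]
    refine integral_mono_ae (L2.integrable_inner _ _) (integrable_const _) ?_
    filter_upwards [(hk.memLp_translate ω x).coeFn_toLp] with y hy
    rw [translate, hy]
    simpa [sq, abs_mul_abs_self] using mul_self_le_mul_self (abs_nonneg _) (hC x y)
  obtain ⟨B, hB⟩ := hbd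
  refine summable_of_sum_range_le (c := ∫ _, B ∂ω) (fun m => sq_nonneg _) fun n => ?_
  have hi : ∀ m, Integrable (fun x => eigenfun ω k b σ m x * eigenfun ω k b σ m x) ω :=
    fun m => (memLp_eigenfun hb m).integrable_mul (memLp_eigenfun hb m)
  calc ∑ m ∈ Finset.range n, σ m ^ 2
      = ∑ m ∈ Finset.range n, ∫ x, σ m ^ 2 * (eigenfun ω k b σ m x * eigenfun ω k b σ m x) ∂ω := by
        simp [integral_const_mul, integral_eigenfun_mul hb]
    _ = ∫ x, ∑ m ∈ Finset.range n,
          σ m ^ 2 * (eigenfun ω k b σ m x * eigenfun ω k b σ m x) ∂ω :=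
        (integral_finsetSum _ fun m _ => (hi m).const_mul _).symm
    _ ≤ ∫ _, B ∂ω := by
        refine integral_mono (integrable_finsetSum _ fun m _ => (hi m).const_mul _)
          (integrable_const _) fun x => le_trans ?_ (hB x)
        have hs := hasSum_inner_sq b (translate hk ω x)
        refine le_trans (le_of_eq (Finset.sum_congr rfl fun m _ => ?_))
          (sum_le_hasSum (Finset.range n) (fun m _ => sq_nonneg _) hs)
        rw [inner_translate hk hb]
        ring

/-- The span may change dimension with the nodes, so the error is written as a countable infimum
over rational weights, each term being a Parseval series in the values `e_m(x_i)`. -/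
theorem measurable_norm_sub_lsApprox_sq (hk : IsAdmissibleKernel k) (hb : IsEigensystem ω k b σ)
    (N : ℕ) (g : Lp ℝ 2 ω) :
    Measurable fun x : Fin N → X => ‖g - lsApprox hk ω x g‖ ^ 2 := by
  simp only [lsApprox, norm_sub_starProjection_span_sq]
  refine Measurable.iInf fun w => ?_
  have hs : ∀ x : Fin N → X, ‖g - ∑ i, (w i : ℝ) • translate hk ω (x i)‖ ^ 2 =
      ∑' m, (inner ℝ (b m) g - σ m * ∑ i, (w i : ℝ) * eigenfun ω k b σ m (x i)) ^ 2 := by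
    intro x
    simp only [← inner_sub_sum_translate hk hb, (hasSum_inner_sq b _).tsum_eq]
  simp only [hs]
  have he : ∀ m, Measurable (eigenfun ω k b σ m) := fun m =>
    (continuous_eigenfun hk b σ m).measurable
  refine Measurable.tsum fun m => ?_
  fun_prop

theorem norm_sub_lsApprox_sq_le (hk : IsAdmissibleKernel k) {N : ℕ} (x : Fin N → X)
    (g : Lp ℝ 2 ω) : ‖g - lsApprox hk ω x g‖ ^ 2 ≤ ‖g‖ ^ 2 := by
  have := norm_sub_starProjection_le (Submodule.span ℝ (Set.range fun i => translate hk ω (x i))) g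
    (Submodule.zero_mem _)
  rw [sub_zero] at this
  exact pow_le_pow_left₀ (norm_nonneg _) this 2

/-- Interpolating the first `N` coefficients of `g_M` by a combination of kernel translates. -/
theorem hasSum_norm_eigenProj_sub_sq (hk : IsAdmissibleKernel k) (hb : IsEigensystem ω k b σ)
    {N M : ℕ} (hM : M ≤ N) (g : Lp ℝ 2 ω) (x : Fin N → X)
    (hx : IsUnit (eigenMatrix (eigenfun ω k b σ) x).det) {d w : Fin N → ℝ}
    (hd : d = fun n : Fin N => if (n : ℕ) < M then inner ℝ (b n) g / σ n else 0)
    (hw : w = (eigenMatrix (eigenfun ω k b σ) x)⁻¹ *ᵥ d) :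
    HasSum (fun m => σ (N + m) ^ 2 * (w ⬝ᵥ fun i => eigenfun ω k b σ (N + m) (x i)) ^ 2)
      (‖eigenProj b M g - ∑ i, w i • translate hk ω (x i)‖ ^ 2) := by
  have hs := hasSum_inner_sq b (eigenProj b M g - ∑ i, w i • translate hk ω (x i))
  simp only [inner_sub_sum_translate hk hb, inner_eigenProj] at hs
  have hEw : eigenMatrix (eigenfun ω k b σ) x *ᵥ w = d := by
    rw [hw, Matrix.mulVec_mulVec, Matrix.mul_nonsing_inv _ hx, Matrix.one_mulVec]
  have h0 : ∀ m ∈ Finset.range N, ((if m < M then inner ℝ (b m) g else 0) -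
      σ m * ∑ i, w i * eigenfun ω k b σ m (x i)) ^ 2 = 0 := by
    intro m hm
    have h := congrFun hEw ⟨m, Finset.mem_range.1 hm⟩
    have h' : ∑ i, w i * eigenfun ω k b σ m (x i) = d ⟨m, Finset.mem_range.1 hm⟩ := by
      rw [← h]
      simp [Matrix.mulVec, dotProduct, eigenMatrix, mul_comm]
    rw [h', hd]
    have := (hb.pos m).ne'
    simp only
    split_ifs
    · field_simp
      simp
    · simp
  rw [← hasSum_nat_add_iff' N, Finset.sum_eq_zero h0, sub_zero] at hs
  refine hs.congr_fun fun m => ?_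
  rw [if_neg (by omega), add_comm m N]
  simp only [dotProduct]
  ring

/-- The pointwise estimate of the squared error, multiplied by the squared determinant of the eigenfunctions. -/
theorem norm_sub_lsApprox_sq_mul_det_sq_le (hk : IsAdmissibleKernel k)
    (hb : IsEigensystem ω k b σ) {N M : ℕ} (hM : M ≤ N) (g : Lp ℝ 2 ω) (x : Fin N → X) :
    ENNReal.ofReal (‖g - lsApprox hk ω x g‖ ^ 2 * (eigenMatrix (eigenfun ω k b σ) x).det ^ 2) ≤
      ENNReal.ofReal (2 * ‖g - eigenProj b M g‖ ^ 2) *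
        ENNReal.ofReal ((eigenMatrix (eigenfun ω k b σ) x).det ^ 2) +
      ENNReal.ofReal 2 * ∑' m, ENNReal.ofReal (σ (N + m) ^ 2) *
        ENNReal.ofReal ((∑ n : Fin N, (if (n : ℕ) < M then inner ℝ (b n) g / σ n else 0) *
        ((eigenMatrix (eigenfun ω k b σ) x).updateRow n
          fun i => eigenfun ω k b σ (N + m) (x i)).det) ^ 2) := by
  -- Degenerate nodes cost nothing: the left side carries the factor `det ^ 2`.
  by_cases hx : (eigenMatrix (eigenfun ω k b σ) x).det = 0
  · simp [hx]
  have hx' : IsUnit (eigenMatrix (eigenfun ω k b σ) x).det := isUnit_iff_ne_zero.2 hx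
  set E := eigenMatrix (eigenfun ω k b σ) x
  set d : Fin N → ℝ := fun n => if (n : ℕ) < M then inner ℝ (b n) g / σ n else 0 with hd
  obtain ⟨w, hw⟩ : ∃ w, w = E⁻¹ *ᵥ d := ⟨_, rfl⟩
  set h := ∑ i, w i • translate hk ω (x i)
  have h1 : ‖g - lsApprox hk ω x g‖ ≤ ‖g - h‖ :=
    norm_sub_starProjection_le _ _ (Submodule.sum_mem _ fun i _ =>
      Submodule.smul_mem _ _ (Submodule.subset_span (Set.mem_range_self i)))
  have h2 : ‖g - h‖ ≤ ‖g - eigenProj b M g‖ + ‖eigenProj b M g - h‖ :=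
    norm_sub_le_norm_sub_add_norm_sub _ _ _
  have h3 : ‖g - lsApprox hk ω x g‖ ^ 2 ≤
      2 * ‖g - eigenProj b M g‖ ^ 2 + 2 * ‖eigenProj b M g - h‖ ^ 2 := by
    have := pow_le_pow_left₀ (norm_nonneg _) (h1.trans h2) 2
    -- `(a + b) ^ 2 ≤ 2 a ^ 2 + 2 b ^ 2`, the source of the factor 2 in the theorem.
    nlinarith [sq_nonneg (‖g - eigenProj b M g‖ - ‖eigenProj b M g - h‖)]
  have h4 := (hasSum_norm_eigenProj_sub_sq hk hb hM g x hx' hd hw).mul_right (E.det ^ 2)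
  have h5 : ∀ m, σ (N + m) ^ 2 * (w ⬝ᵥ fun i => eigenfun ω k b σ (N + m) (x i)) ^ 2 * E.det ^ 2 =
      σ (N + m) ^ 2 * (∑ n : Fin N, d n *
        (E.updateRow n fun i => eigenfun ω k b σ (N + m) (x i)).det) ^ 2 := by
    intro m
    rw [← det_mul_dotProduct_inv_mulVec hx', ← hw]
    ring
  simp only [h5] at h4
  have h6 : ∑' m, ENNReal.ofReal (σ (N + m) ^ 2) * ENNReal.ofReal ((∑ n : Fin N, d n *
      (E.updateRow n fun i => eigenfun ω k b σ (N + m) (x i)).det) ^ 2) =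
      ENNReal.ofReal (‖eigenProj b M g - h‖ ^ 2 * E.det ^ 2) := by
    rw [← h4.tsum_eq, ENNReal.ofReal_tsum_of_nonneg (fun m => by positivity) h4.summable]
    exact tsum_congr fun m => (ENNReal.ofReal_mul (sq_nonneg _)).symm
  rw [h6, ← ENNReal.ofReal_mul (by positivity),
    ← ENNReal.ofReal_mul (by positivity), ← ENNReal.ofReal_add (by positivity) (by positivity)]
  refine ENNReal.ofReal_le_ofReal ?_
  nlinarith [mul_le_mul_of_nonneg_right h3 (sq_nonneg E.det)]

theorem measurable_det_eigenMatrix (hk : IsAdmissibleKernel k) (N : ℕ) :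
    Measurable fun x : Fin N → X => (eigenMatrix (eigenfun ω k b σ) x).det := by
  have he : ∀ m, Measurable (eigenfun ω k b σ m) := fun m =>
    (continuous_eigenfun hk b σ m).measurable
  simp only [Matrix.det_apply', eigenMatrix, Matrix.of_apply]
  fun_prop

/-- Working in `ENNReal` lets Tonelli exchange the series and the integral. -/
theorem lintegral_norm_sub_lsApprox_sq_le (hk : IsAdmissibleKernel k)
    (hb : IsEigensystem ω k b σ) {N M : ℕ} (hM : M ≤ N) (g : Lp ℝ 2 ω)
    [IsProbabilityMeasure (dppLaw ω (projKernel (eigenfun ω k b σ) (Finset.range N)) N)] :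
    ∫⁻ x, ENNReal.ofReal (‖g - lsApprox hk ω x g‖ ^ 2)
      ∂(dppLaw ω (projKernel (eigenfun ω k b σ) (Finset.range N)) N) ≤
    ENNReal.ofReal (2 * (‖g - eigenProj b M g‖ ^ 2 +
      (∑ n ∈ Finset.range M, inner ℝ g (b n) ^ 2 / σ n ^ 2) * ∑' m, σ (N + m) ^ 2)) := by
  set e := eigenfun ω k b σ
  set d : Fin N → ℝ := fun n => if (n : ℕ) < M then inner ℝ (b n) g / σ n else 0 with hd
  have hN0 : (0 : ℝ) < N.factorial := by exact_mod_cast N.factorial_pos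
  have hsum : Summable fun m => σ (N + m) ^ 2 := by
    simpa [add_comm] using (summable_nat_add_iff N).2 (summable_sq_eigenvalue hk hb)
  have hdet : Measurable fun x : Fin N → X => (eigenMatrix e x).det :=
    measurable_det_eigenMatrix hk N
  have hdens : Measurable fun x : Fin N → X =>
      ENNReal.ofReal ((N.factorial : ℝ)⁻¹ * (eigenMatrix e x).det ^ 2) := by fun_prop
  have hlaw : dppLaw ω (projKernel e (Finset.range N)) N = (Measure.pi fun _ => ω).withDensity
      fun x => ENNReal.ofReal ((N.factorial : ℝ)⁻¹ * (eigenMatrix e x).det ^ 2) := by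
    simp only [dppLaw, det_projKernel]
  -- The normalization of `det ^ 2` is read off from the total mass of the law, which is a
  -- probability measure by assumption.
  have hone : ENNReal.ofReal (N.factorial : ℝ)⁻¹ *
      ∫⁻ x : Fin N → X, ENNReal.ofReal ((eigenMatrix e x).det ^ 2) ∂(Measure.pi fun _ => ω) = 1 := by
    rw [← measure_univ (μ := dppLaw ω (projKernel e (Finset.range N)) N), hlaw,
      withDensity_apply _ MeasurableSet.univ, Measure.restrict_univ,
      ← lintegral_const_mul _ (by fun_prop)]
    exact lintegral_congr fun x => (ENNReal.ofReal_mul (by positivity)).symm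
  have hterm : ∀ m, ∫⁻ x : Fin N → X, ENNReal.ofReal (σ (N + m) ^ 2) * ENNReal.ofReal
      ((∑ n, d n * ((eigenMatrix e x).updateRow n fun i => e (N + m) (x i)).det) ^ 2)
        ∂(Measure.pi fun _ => ω) =
      ENNReal.ofReal (σ (N + m) ^ 2 * (N.factorial * ∑ n, d n ^ 2)) := by
    intro m
    rw [lintegral_const_mul' _ _ ENNReal.ofReal_ne_top, ← ofReal_integral_eq_lintegral_ofReal
      (integrable_sum_det_updateRow_sq hb _ d) (Filter.Eventually.of_forall fun x => sq_nonneg _),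
      integral_sum_det_updateRow_sq hb (Nat.le_add_right N m), ENNReal.ofReal_mul (sq_nonneg _)]
  have hdsum : ∑ n, d n ^ 2 = ∑ n ∈ Finset.range M, inner ℝ g (b n) ^ 2 / σ n ^ 2 := by
    have h1 : ∑ n, d n ^ 2 = ∑ n ∈ Finset.range N,
        if n < M then inner ℝ g (b n) ^ 2 / σ n ^ 2 else 0 := by
      rw [Finset.sum_range]
      refine Finset.sum_congr rfl fun n _ => ?_
      rw [hd]
      simp only
      split_ifs
      · rw [div_pow, real_inner_comm]
      · simp
    rw [h1, ← Finset.sum_filter]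
    congr 1
    ext n
    simp only [Finset.mem_filter, Finset.mem_range]
    omega
  have htot : ∑' m, ENNReal.ofReal (σ (N + m) ^ 2 * (N.factorial * ∑ n, d n ^ 2)) =
      ENNReal.ofReal (N.factorial * ((∑ n, d n ^ 2) * ∑' m, σ (N + m) ^ 2)) := by
    rw [← ENNReal.ofReal_tsum_of_nonneg (fun m => by positivity) (hsum.mul_right _), tsum_mul_right]
    congr 1
    ring
  rw [hlaw, lintegral_withDensity_eq_lintegral_mul _ hdens
    (measurable_norm_sub_lsApprox_sq hk hb N g).ennreal_ofReal]
  simp only [Pi.mul_apply]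
  calc ∫⁻ x : Fin N → X, ENNReal.ofReal ((N.factorial : ℝ)⁻¹ * (eigenMatrix e x).det ^ 2) *
          ENNReal.ofReal (‖g - lsApprox hk ω x g‖ ^ 2) ∂(Measure.pi fun _ => ω)
      = ENNReal.ofReal (N.factorial : ℝ)⁻¹ * ∫⁻ x : Fin N → X,
          ENNReal.ofReal (‖g - lsApprox hk ω x g‖ ^ 2 * (eigenMatrix e x).det ^ 2)
            ∂(Measure.pi fun _ => ω) := by
        rw [← lintegral_const_mul' _ _ ENNReal.ofReal_ne_top]
        refine lintegral_congr fun x => ?_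
        rw [← ENNReal.ofReal_mul (by positivity),
          ← ENNReal.ofReal_mul (by positivity)]
        congr 1
        ring
    _ ≤ ENNReal.ofReal (N.factorial : ℝ)⁻¹ * ∫⁻ x : Fin N → X,
          (ENNReal.ofReal (2 * ‖g - eigenProj b M g‖ ^ 2) *
            ENNReal.ofReal ((eigenMatrix e x).det ^ 2) +
          ENNReal.ofReal 2 * ∑' m, ENNReal.ofReal (σ (N + m) ^ 2) * ENNReal.ofReal ((∑ n : Fin N, d n *
            ((eigenMatrix e x).updateRow n fun i => e (N + m) (x i)).det) ^ 2))
            ∂(Measure.pi fun _ => ω) := by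
        gcongr with x
        exact norm_sub_lsApprox_sq_mul_det_sq_le hk hb hM g x
    _ = ENNReal.ofReal (2 * ‖g - eigenProj b M g‖ ^ 2) + ENNReal.ofReal (N.factorial : ℝ)⁻¹ *
          (ENNReal.ofReal 2 * ENNReal.ofReal (N.factorial * ((∑ n, d n ^ 2) * ∑' m, σ (N + m) ^ 2))) := by
        rw [lintegral_add_left (by fun_prop), mul_add, lintegral_const_mul' _ _ ENNReal.ofReal_ne_top,
          mul_left_comm, hone, mul_one, lintegral_const_mul' _ _ ENNReal.ofReal_ne_top,
          lintegral_tsum, tsum_congr hterm, htot]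
        exact fun m => (integrable_sum_det_updateRow_sq hb (N + m)
          d).aestronglyMeasurable.aemeasurable.ennreal_ofReal.const_mul _
    _ = ENNReal.ofReal (2 * (‖g - eigenProj b M g‖ ^ 2 +
          (∑ n ∈ Finset.range M, inner ℝ g (b n) ^ 2 / σ n ^ 2) * ∑' m, σ (N + m) ^ 2)) := by
        have h0 : 0 ≤ ∑' m, σ (N + m) ^ 2 := tsum_nonneg fun m => sq_nonneg _
        have h1 : 0 ≤ ∑ n, d n ^ 2 := Finset.sum_nonneg fun n _ => sq_nonneg _
        rw [← ENNReal.ofReal_mul (by positivity),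
          ← ENNReal.ofReal_mul (by positivity), ← ENNReal.ofReal_add (by positivity) (by positivity),
          ← hdsum]
        congr 1
        field_simp

end Translate

end DPPLeastSquares

/-! ### The main theorem -/

theorem mainTheorem1 {X : Type*} [MetricSpace X] [MeasurableSpace X] [BorelSpace X]
    (ω : Measure X) [IsFiniteMeasure ω] [ω.IsOpenPosMeasure]
    (k : X → X → ℝ) (hk : IsAdmissibleKernel k)
    (F : Type*) [NormedAddCommGroup F] [InnerProductSpace ℝ F] [CompleteSpace F] [RKHS ℝ F X ℝ]
    (hF : HasKernel F k)
    (b : HilbertBasis ℕ ℝ (Lp ℝ 2 ω)) (σ : ℕ → ℝ)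
    (hb : IsEigensystem ω k b σ)
    (f : F) (N : ℕ) (hN : 1 ≤ N)
    {Ω : Type*} [MeasurableSpace Ω] (P : Measure Ω) [IsProbabilityMeasure P]
    (x : Ω → Fin N → X)
    (hx : HasLaw x (dppLaw ω (projKernel
      (eigenfun ω k b σ) (Finset.range N)) N) P) :
    Summable (fun m : ℕ => σ (N + m) ^ 2) ∧
    Integrable (fun t => ‖toL2 hk hF ω f -
      lsApprox hk ω (x t) (toL2 hk hF ω f)‖ ^ 2) P ∧
    ∫ t, ‖toL2 hk hF ω f -
      lsApprox hk ω (x t) (toL2 hk hF ω f)‖ ^ 2 ∂P ≤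
      2 * (Finset.Icc 1 N).inf' (Finset.nonempty_Icc.2 hN) (fun M : ℕ =>
        ‖toL2 hk hF ω f -
          eigenProj b M (toL2 hk hF ω f)‖ ^ 2 +
        (∑ n ∈ Finset.range M, (inner ℝ (toL2 hk hF ω f) (b n)) ^ 2 / σ n ^ 2) *
          ∑' m : ℕ, σ (N + m) ^ 2) := by
  have hlaw : IsProbabilityMeasure (dppLaw ω (projKernel (eigenfun ω k b σ) (Finset.range N)) N) :=
    hx.isProbabilityMeasure_iff.1 inferInstance
  set g := toL2 hk hF ω f
  have hmeas := measurable_norm_sub_lsApprox_sq hk hb N g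
  have hint : Integrable (fun t => ‖g - lsApprox hk ω (x t) g‖ ^ 2) P := by
    refine Integrable.of_bound (hmeas.comp_aemeasurable hx.aemeasurable).aestronglyMeasurable
      (‖g‖ ^ 2) (Filter.Eventually.of_forall fun t => ?_)
    rw [Real.norm_of_nonneg (sq_nonneg _)]
    exact norm_sub_lsApprox_sq_le hk (x t) g
  refine ⟨?_, hint, ?_⟩
  · simpa [add_comm] using (summable_nat_add_iff N).2 (summable_sq_eigenvalue hk hb)
  -- The minimum is attained, so the bound for a single `M ≤ N` suffices.
  obtain ⟨M, hM, hMeq⟩ := Finset.exists_mem_eq_inf' (Finset.nonempty_Icc.2 hN) (fun M : ℕ =>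
    ‖g - eigenProj b M g‖ ^ 2 + (∑ n ∈ Finset.range M, (inner ℝ g (b n)) ^ 2 / σ n ^ 2) *
      ∑' m : ℕ, σ (N + m) ^ 2)
  rw [hMeq, integral_eq_lintegral_of_nonneg_ae (Filter.Eventually.of_forall fun t => sq_nonneg _)
    hint.aestronglyMeasurable]
  refine ENNReal.toReal_le_of_le_ofReal ?_ ?_
  · have : 0 ≤ ∑' m, σ (N + m) ^ 2 := tsum_nonneg fun m => sq_nonneg _
    have : 0 ≤ ∑ n ∈ Finset.range M, (inner ℝ g (b n)) ^ 2 / σ n ^ 2 :=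
      Finset.sum_nonneg fun n _ => by positivity
    positivity
  · have h := hx.lintegral_comp (f := fun y => ENNReal.ofReal (‖g - lsApprox hk ω y g‖ ^ 2))
      hmeas.ennreal_ofReal.aemeasurable
    rw [h]
    exact lintegral_norm_sub_lsApprox_sq_le hk hb (Finset.mem_Icc.1 hM).2 g
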